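/- **Theorem.** Checking state-boundedness of data-centric dynamic systems (DCDSs) with nondeterministic services is undecidable: there is no algorithm which, given a DCDS $\mathcal S$, decides whether $\mathcal S$ is state-bounded. (On inputs that are not DCDSs the algorithm may behave arbitrarily; in particular, it need not halt.) Here $\mathcal C$ is a countably infinite set of constants (say $\mathcal C=\mathbb N$), and the *active domain* $\mathrm{adom}(I)$ of a database instance $I$ is the set of constants occurring in $I$. A DCDS consists of * a finite relational schema $\mathcal R$ and a finite initial instance $I_0$ of $\mathcal R$ over $\mathcal C$; * finitely many equality constraints $Q\to\bigwedge_j z_j=y_j$, where $Q$ is a domain-independent first-order query over $\mathcal R$ with constants from $\mathrm{adom}(I_0)$, and the $z_j,y_j$ are free variables of $Q$ or constants from $\mathrm{adom}(I_0)$; the instance $I_0$ satisfies these constraints; * a finite set $\mathcal F$ of service names with arities; * finitely many actions $\alpha(p_1,\dots,p_n):\{e_1,\dots,e_m\}$ with effects $e_i = (q_i^+\wedge Q_i^-\rightsquigarrow E_i)$, where $q_i^+$ is a union of conjunctive queries, $Q_i^-$ is a first-order formula whose free variables are, apart from the parameters, among those of $q_i^+$, both over $\mathcal R$ and with constants from $\mathrm{adom}(I_0)$,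 and $E_i$ is a finite set of $\mathcal R$-facts whose terms are constants from $\mathrm{adom}(I_0)$, parameters, free variables of $q_i^+$, or service calls $f(t_1,\dots,t_k)$ with $f\in\mathcal F$ applied to such terms; * finitely many condition-action rules $Q\mapsto\alpha$, where $Q$ is a first-order query over $\mathcal R$ with constants from $\mathrm{adom}(I_0)$, whose free variables are exactly the parameters of $\alpha$. There is a transition $I\Rightarrow I'$ if there are a rule $Q\mapsto\alpha$, an assignment $\sigma$ of constants to the parameters of $\alpha$ with $I\models Q\sigma$, and a function $\theta$ assigning a constant to every service call occurring in $$\mathrm{DO}(I,\alpha\sigma)=\bigcup_{i}\ \bigcup_{\vartheta\in \mathrm{ans}((q_i^+\wedge Q_i^-)\sigma,\,I)}E_i\sigma\vartheta,$$ such that $I'=\mathrm{DO}(I,\alpha\sigma)\theta$ and $I'$ satisfies all the equality constraints. The function $\theta$ is chosen afresh in every transition (the services are nondeterministic). The states of $\mathcal S$ are the instances reachable from $I_0$ by finitely many transitions. $\mathcal S$ is *state-bounded* if there is a finite $b$ such that $|\mathrm{adom}(I)|<b$ for every state $I$. -/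

import Mathlib

namespace DataCentric

/-! ### Terms, atoms and first-order queries

The constants (values) are the natural numbers, a countably infinite set; variables, relation
names and service names are natural numbers as well. -/

/-- A term of a query: a variable or a constant (interpreted as itself). -/
inductive Term where
  | var (x : ℕ)
  | const (c : ℕ)

/-- `R(t₁, …, tₙ)`, with `R` a relation name and arguments in `T`. -/
structure Atom (T : Type) where
  rel : ℕ
  args : List T

/-- A fact: an atom whose arguments are constants. -/
abbrev Fact := Atom ℕ

/-- A term over `T`, or a service call `f(t₁, …, tₙ)` with arguments in `T` (calls are not
nested). -/
inductive CallTerm (T : Type) where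
  | plain (t : T)
  | call (f : ℕ) (args : List T)

/-- First-order formulas with equality, with named variables; the remaining connectives and
`∀` are abbreviations. -/
inductive Formula where
  | tru
  | atom (a : Atom Term)
  | eq (s t : Term)
  | neg (φ : Formula)
  | and (φ ψ : Formula)
  | ex (x : ℕ) (φ : Formula)

def Atom.map {T U : Type} (g : T → U) (a : Atom T) : Atom U := ⟨a.rel, a.args.map g⟩

def CallTerm.map {T U : Type} (g : T → U) : CallTerm T → CallTerm U
  | .plain t => .plain (g t)
  | .call f args => .call f (args.map g)

/-- The terms occurring in a possible service call. -/
def CallTerm.terms {T : Type} : CallTerm T → List T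
  | .plain t => [t]
  | .call _ args => args

def Term.eval (v : ℕ → ℕ) : Term → ℕ
  | .var x => v x
  | .const c => c

def Term.vars : Term → Set ℕ
  | .var x => {x}
  | .const _ => ∅

def Term.consts : Term → Set ℕ
  | .var _ => ∅
  | .const c => {c}

/-- The free variables of a formula. -/
def Formula.fv : Formula → Set ℕ
  | .tru => ∅
  | .atom a => {x | ∃ t ∈ a.args, x ∈ t.vars}
  | .eq s t => s.vars ∪ t.vars
  | .neg φ => φ.fv
  | .and φ ψ => φ.fv ∪ ψ.fv
  | .ex x φ => φ.fv \ {x}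

/-- The constants occurring in a formula. -/
def Formula.consts : Formula → Set ℕ
  | .tru => ∅
  | .atom a => {c | ∃ t ∈ a.args, c ∈ t.consts}
  | .eq s t => s.consts ∪ t.consts
  | .neg φ => φ.consts
  | .and φ ψ => φ.consts ∪ ψ.consts
  | .ex _ φ => φ.consts

/-- `schema[R]? = some n` says that `R` is a relation of arity `n`; an atom conforms to the schema
when its relation exists and it has the right number of arguments. -/
def Atom.Conforms {T : Type} (schema : List ℕ) (a : Atom T) : Prop :=
  schema[a.rel]? = some a.args.length

/-- The formula is a query over the given schema. -/
def Formula.Conforms (schema : List ℕ) : Formula → Prop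
  | .tru => True
  | .atom a => a.Conforms schema
  | .eq _ _ => True
  | .neg φ => φ.Conforms schema
  | .and φ ψ => φ.Conforms schema ∧ ψ.Conforms schema
  | .ex _ φ => φ.Conforms schema

/-! ### Instances and answers -/

/-- The active domain: all constants occurring in the instance. -/
def adom (I : Set Fact) : Set ℕ := {c | ∃ f ∈ I, c ∈ f.args}

/-- Satisfaction in the instance `I` under the valuation `v`, with quantifiers ranging
over `D`. -/
def Formula.Sat (D : Set ℕ) (I : Set Fact) : (ℕ → ℕ) → Formula → Prop
  | _, .tru => True
  | v, .atom a => a.map (Term.eval v) ∈ I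
  | v, .eq s t => s.eval v = t.eval v
  | v, .neg φ => ¬ Formula.Sat D I v φ
  | v, .and φ ψ => Formula.Sat D I v φ ∧ Formula.Sat D I v ψ
  | v, .ex x φ => ∃ c ∈ D, Formula.Sat D I (Function.update v x c) φ

/-- The restriction of `v` to the free variables of `φ` is an answer to `φ` over `I` when the
underlying domain is `D`. -/
def Formula.Answer (D : Set ℕ) (I : Set Fact) (v : ℕ → ℕ) (φ : Formula) : Prop :=
  (∀ x ∈ φ.fv, v x ∈ D) ∧ φ.Sat D I v

/-- Domain independence: over every (finite) database instance, the answers do not depend on the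
choice of the underlying domain, as long as it contains the active domain of the instance and the
constants of the query. -/
def Formula.DomainIndependent (schema : List ℕ) (φ : Formula) : Prop :=
  ∀ I : Set Fact, I.Finite → (∀ f ∈ I, f.Conforms schema) →
    ∀ D D' : Set ℕ, adom I ∪ φ.consts ⊆ D → adom I ∪ φ.consts ⊆ D' →
      ∀ v : ℕ → ℕ, φ.Answer D I v ↔ φ.Answer D' I v

/-! ### Syntax of data-centric dynamic systems -/

/-- An equality constraint `Q → ⋀ⱼ zⱼ = yⱼ`. -/
structure EqConstraint where
  query : Formula
  eqs : List (Term × Term)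

/-- A union of conjunctive queries with free variables `head`: a disjunction of conjunctions of
atoms. In each disjunct, the variables other than those in `head` and the action parameters are
existentially quantified. -/
structure UCQ where
  head : List ℕ
  disjuncts : List (List (Atom Term))

/-- An effect specification `q⁺ ∧ Q⁻ ⇝ E`. -/
structure Effect where
  pos : UCQ
  filter : Formula
  add : List (Atom (CallTerm Term))

/-- An action: its input parameters (which are variables) and its effect specifications. -/
structure Action where
  params : List ℕ
  effects : List Effect

/-- A condition-action rule `Q ↦ α`, with `α` given by its position in the list of actions. -/
structure Rule where
  guard : Formula
  action : ℕ

/-- The raw finite description of a data-centric dynamic system. Data layer: the schema (the list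
of arities of the relations), the equality constraints and the initial instance. Process layer:
the services (the list of their arities), the actions and the condition-action rules. -/
structure System where
  schema : List ℕ
  constraints : List EqConstraint
  init : List Fact
  services : List ℕ
  actions : List Action
  rules : List Rule

/-- The initial instance, as a set of facts. -/
def System.I₀ (S : System) : Set Fact := {f | f ∈ S.init}

def EqConstraint.Holds (k : EqConstraint) (I : Set Fact) : Prop :=
  ∀ v : ℕ → ℕ, k.query.Answer Set.univ I v → ∀ e ∈ k.eqs, e.1.eval v = e.2.eval v

/-! ### Which descriptions are data-centric dynamic systems -/

def EqConstraint.WellFormed (S : System) (k : EqConstraint) : Prop :=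
  k.query.Conforms S.schema ∧ k.query.consts ⊆ adom S.I₀ ∧
  k.query.DomainIndependent S.schema ∧
  ∀ e ∈ k.eqs, (e.1.vars ∪ e.2.vars ⊆ k.query.fv) ∧ (e.1.consts ∪ e.2.consts ⊆ adom S.I₀)

/-- Every atom is over the schema and uses constants of the initial instance; the free variables
differ from the parameters, and each of them occurs in every disjunct. -/
def UCQ.WellFormed (S : System) (params : List ℕ) (q : UCQ) : Prop :=
  q.head.Disjoint params ∧
  ∀ d ∈ q.disjuncts,
    (∀ a ∈ d, a.Conforms S.schema ∧ ∀ t ∈ a.args, t.consts ⊆ adom S.I₀) ∧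
    ∀ x ∈ q.head, ∃ a ∈ d, ∃ t ∈ a.args, x ∈ t.vars

/-- The terms of the added facts are built from free variables of `q⁺`, parameters and constants
of the initial instance, and their service calls respect the arities of the services. -/
def Effect.WellFormed (S : System) (params : List ℕ) (e : Effect) : Prop :=
  e.pos.WellFormed S params ∧
  (e.filter.Conforms S.schema ∧ e.filter.consts ⊆ adom S.I₀ ∧
    e.filter.fv ⊆ {x | x ∈ e.pos.head ∨ x ∈ params}) ∧
  ∀ a ∈ e.add, a.Conforms S.schema ∧ ∀ u ∈ a.args,
    (∀ t ∈ u.terms, t.consts ⊆ adom S.I₀ ∧ t.vars ⊆ {x | x ∈ e.pos.head ∨ x ∈ params}) ∧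
    ∀ f args, u = .call f args → S.services[f]? = some args.length

def Action.WellFormed (S : System) (α : Action) : Prop :=
  α.params.Nodup ∧ ∀ e ∈ α.effects, e.WellFormed S α.params

/-- The action exists, and the free variables of the guard are exactly its parameters. -/
def Rule.WellFormed (S : System) (r : Rule) : Prop :=
  r.guard.Conforms S.schema ∧ r.guard.consts ⊆ adom S.I₀ ∧
  ∃ α, S.actions[r.action]? = some α ∧ r.guard.fv = {x | x ∈ α.params}

/-- The description is a data-centric dynamic system (DCDS): all its parts obey the syntactic
conditions, the constraints are domain independent, and the initial instance conforms to the schema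
and satisfies the constraints. -/
structure System.IsDCDS (S : System) : Prop where
  init_conforms : ∀ f ∈ S.I₀, f.Conforms S.schema
  constraints_wf : ∀ k ∈ S.constraints, k.WellFormed S
  init_sat : ∀ k ∈ S.constraints, k.Holds S.I₀
  actions_wf : ∀ α ∈ S.actions, α.WellFormed S
  rules_wf : ∀ r ∈ S.rules, r.WellFormed S

/-! ### Semantics with nondeterministic services -/

/-- `q⁺σ` is true in `I` for the answer `v`, where `v` also carries the values of the action
parameters: the other variables of a disjunct are existentially quantified. -/
def UCQ.Sat (q : UCQ) (params : List ℕ) (I : Set Fact) (v : ℕ → ℕ) : Prop :=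
  ∃ d ∈ q.disjuncts, ∃ w : ℕ → ℕ, (∀ x, x ∈ q.head ∨ x ∈ params → w x = v x) ∧
    ∀ a ∈ d, a.map (Term.eval w) ∈ I

/-- `DO(I, ασ)`: the facts, over constants and ground service calls, obtained by grounding the
effects on all answers to their queries. The valuation `v` combines the parameter assignment `σ`
with the answer. -/
def Action.doEffects (α : Action) (I : Set Fact) (σ : ℕ → ℕ) : Set (Atom (CallTerm ℕ)) :=
  {g | ∃ e ∈ α.effects, ∃ v : ℕ → ℕ, (∀ p ∈ α.params, v p = σ p) ∧
    e.pos.Sat α.params I v ∧ e.filter.Sat Set.univ I v ∧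
    ∃ a ∈ e.add, g = a.map (CallTerm.map (Term.eval v))}

/-- Replacing a ground service call by its result. -/
def CallTerm.resolve (θ : ℕ → List ℕ → ℕ) : CallTerm ℕ → ℕ
  | .plain c => c
  | .call f args => θ f args

/-- One concrete execution step `I ⇒ I'`: some rule `Q ↦ α`, some `σ` legal for `α` in `I`, and
some evaluation `θ` of the service calls, chosen anew in every step, give
`I' = DO(I, ασ)θ`, and `I'` satisfies the constraints. (Only the values of `σ` at the parameters
and of `θ` at the calls issued in the step matter.) -/
def System.Step (S : System) (I I' : Set Fact) : Prop :=
  ∃ r ∈ S.rules, ∃ α, S.actions[r.action]? = some α ∧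
    ∃ σ : ℕ → ℕ, r.guard.Answer Set.univ I σ ∧
    ∃ θ : ℕ → List ℕ → ℕ,
      I' = Atom.map (CallTerm.resolve θ) '' α.doEffects I σ ∧
      ∀ k ∈ S.constraints, k.Holds I'

/-- The states of the concrete transition system: the instances reachable from the initial one. -/
def System.IsState (S : System) (I : Set Fact) : Prop :=
  Relation.ReflTransGen S.Step S.I₀ I

/-- State-boundedness: the sizes of the active domains of all states have a common finite bound. -/
def System.StateBounded (S : System) : Prop :=
  ∃ b : ℕ, ∀ I, S.IsState I → (adom I).encard < b

/-! ### Effective encoding of the descriptions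

Formulas are numbered by structural recursion, and the other syntactic objects are tuples and lists
of already numbered ones. -/

def Term.equiv : Term ≃ ℕ ⊕ ℕ where
  toFun | .var x => .inl x | .const c => .inr c
  invFun | .inl x => .var x | .inr c => .const c
  left_inv t := by cases t <;> rfl
  right_inv t := by cases t <;> rfl

instance Term.instDenumerable : Denumerable Term := Denumerable.ofEquiv _ Term.equiv

def Atom.equiv (T : Type) : Atom T ≃ ℕ × List T where
  toFun a := (a.rel, a.args)
  invFun p := ⟨p.1, p.2⟩
  left_inv _ := rfl
  right_inv _ := rfl

instance Atom.instPrimcodable {T : Type} [Primcodable T] : Primcodable (Atom T) :=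
  Primcodable.ofEquiv _ (Atom.equiv T)

def CallTerm.equiv (T : Type) : CallTerm T ≃ T ⊕ (ℕ × List T) where
  toFun | .plain t => .inl t | .call f args => .inr (f, args)
  invFun | .inl t => .plain t | .inr p => .call p.1 p.2
  left_inv t := by cases t <;> rfl
  right_inv t := by cases t <;> rfl

instance CallTerm.instPrimcodable {T : Type} [Primcodable T] : Primcodable (CallTerm T) :=
  Primcodable.ofEquiv _ (CallTerm.equiv T)

/-- The number of a formula. -/
def Formula.toNat : Formula → ℕ
  | .tru => 0
  | .atom a => 5 * Encodable.encode (a.rel, a.args) + 1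
  | .eq s t => 5 * Encodable.encode (s, t) + 2
  | .neg φ => 5 * φ.toNat + 3
  | .and φ ψ => 5 * Nat.pair φ.toNat ψ.toNat + 4
  | .ex x φ => 5 * Nat.pair x φ.toNat + 5

/-- The formula with a given number. -/
def Formula.ofNat : ℕ → Formula
  | 0 => .tru
  | n + 1 =>
    have hm : n / 5 < n + 1 := Nat.lt_succ_of_le (Nat.div_le_self n 5)
    have _h1 : (n / 5).unpair.1 < n + 1 := lt_of_le_of_lt (n / 5).unpair_left_le hm
    have _h2 : (n / 5).unpair.2 < n + 1 := lt_of_le_of_lt (n / 5).unpair_right_le hm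
    match n % 5 with
    | 0 =>
      let p := Denumerable.ofNat (ℕ × List Term) (n / 5)
      .atom ⟨p.1, p.2⟩
    | 1 =>
      let p := Denumerable.ofNat (Term × Term) (n / 5)
      .eq p.1 p.2
    | 2 => .neg (Formula.ofNat (n / 5))
    | 3 => .and (Formula.ofNat (n / 5).unpair.1) (Formula.ofNat (n / 5).unpair.2)
    | _ => .ex (n / 5).unpair.1 (Formula.ofNat (n / 5).unpair.2)
  termination_by n => n
  decreasing_by all_goals assumption

theorem Formula.ofNat_toNat (φ : Formula) : Formula.ofNat φ.toNat = φ := by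
  have hd : ∀ m r : ℕ, r < 5 → (5 * m + r) / 5 = m := by intro m r h; omega
  have hr : ∀ m r : ℕ, r < 5 → (5 * m + r) % 5 = r := by intro m r h; omega
  induction φ with
  | tru => rw [Formula.toNat, Formula.ofNat]
  | atom a =>
    have h1 := hd (Encodable.encode (a.rel, a.args)) 0 (by omega)
    have h2 := hr (Encodable.encode (a.rel, a.args)) 0 (by omega)
    rw [Nat.add_zero] at h1 h2
    rw [Formula.toNat, Formula.ofNat]
    simp only [h1, h2, Denumerable.ofNat_encode]
  | eq s t =>
    rw [Formula.toNat, Formula.ofNat]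
    simp only [hd _ 1 (by omega), hr _ 1 (by omega), Denumerable.ofNat_encode]
  | neg φ ih =>
    rw [Formula.toNat, Formula.ofNat]
    simp only [hd _ 2 (by omega), hr _ 2 (by omega), ih]
  | and φ ψ ih1 ih2 =>
    rw [Formula.toNat, Formula.ofNat]
    simp only [hd _ 3 (by omega), hr _ 3 (by omega), Nat.unpair_pair, ih1, ih2]
  | ex x φ ih =>
    rw [Formula.toNat, Formula.ofNat]
    simp only [hd _ 4 (by omega), hr _ 4 (by omega), Nat.unpair_pair, ih]

theorem Formula.toNat_ofNat (n : ℕ) : (Formula.ofNat n).toNat = n := by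
  induction n using Nat.strong_induction_on with
  | _ n ih =>
    cases n with
    | zero => rw [Formula.ofNat, Formula.toNat]
    | succ n =>
      have hm : n / 5 < n + 1 := Nat.lt_succ_of_le (Nat.div_le_self n 5)
      have h0 := ih _ hm
      have h1 := ih _ (lt_of_le_of_lt (n / 5).unpair_left_le hm)
      have h2 := ih _ (lt_of_le_of_lt (n / 5).unpair_right_le hm)
      have hn := Nat.div_add_mod n 5
      have hlt := Nat.mod_lt n (show 5 > 0 by omega)
      rw [Formula.ofNat]
      generalize n % 5 = r at hn hlt ⊢
      interval_cases r
      · simp only [Formula.toNat, Prod.mk.eta, Denumerable.encode_ofNat]; omega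
      · simp only [Formula.toNat, Prod.mk.eta, Denumerable.encode_ofNat]; omega
      · simp only [Formula.toNat, h0]; omega
      · simp only [Formula.toNat, h1, h2, Nat.pair_unpair]; omega
      · simp only [Formula.toNat, h2, Nat.pair_unpair]; omega

instance Formula.instDenumerable : Denumerable Formula :=
  Denumerable.mk' ⟨Formula.toNat, Formula.ofNat, Formula.ofNat_toNat, Formula.toNat_ofNat⟩

def EqConstraint.equiv : EqConstraint ≃ Formula × List (Term × Term) where
  toFun k := (k.query, k.eqs)
  invFun p := ⟨p.1, p.2⟩
  left_inv _ := rfl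
  right_inv _ := rfl

instance EqConstraint.instPrimcodable : Primcodable EqConstraint :=
  Primcodable.ofEquiv _ EqConstraint.equiv

def UCQ.equiv : UCQ ≃ List ℕ × List (List (Atom Term)) where
  toFun q := (q.head, q.disjuncts)
  invFun p := ⟨p.1, p.2⟩
  left_inv _ := rfl
  right_inv _ := rfl

instance UCQ.instPrimcodable : Primcodable UCQ := Primcodable.ofEquiv _ UCQ.equiv

def Effect.equiv : Effect ≃ UCQ × Formula × List (Atom (CallTerm Term)) where
  toFun e := (e.pos, e.filter, e.add)
  invFun p := ⟨p.1, p.2.1, p.2.2⟩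
  left_inv _ := rfl
  right_inv _ := rfl

instance Effect.instPrimcodable : Primcodable Effect := Primcodable.ofEquiv _ Effect.equiv

def Action.equiv : Action ≃ List ℕ × List Effect where
  toFun α := (α.params, α.effects)
  invFun p := ⟨p.1, p.2⟩
  left_inv _ := rfl
  right_inv _ := rfl

instance Action.instPrimcodable : Primcodable Action := Primcodable.ofEquiv _ Action.equiv

def Rule.equiv : Rule ≃ Formula × ℕ where
  toFun r := (r.guard, r.action)
  invFun p := ⟨p.1, p.2⟩
  left_inv _ := rfl
  right_inv _ := rfl

instance Rule.instPrimcodable : Primcodable Rule := Primcodable.ofEquiv _ Rule.equiv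

def System.equiv :
    System ≃ List ℕ × List EqConstraint × List Fact × List ℕ × List Action × List Rule where
  toFun S := (S.schema, S.constraints, S.init, S.services, S.actions, S.rules)
  invFun p := ⟨p.1, p.2.1, p.2.2.1, p.2.2.2.1, p.2.2.2.2.1, p.2.2.2.2.2⟩
  left_inv _ := rfl
  right_inv _ := rfl

instance System.instPrimcodable : Primcodable System := Primcodable.ofEquiv _ System.equiv

end DataCentric

namespace DataCentric

/-! ### Positive clauses and their immediate consequences -/

/-! The halting problem reduces to state-boundedness. Fix a code `u` and encode its evaluation by
finitely many positive Horn clauses over a successor relation. The system `evalSystem u n` starts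
from the chain `0, …, n`. It has one action without parameters, which in each step copies all facts,
applies every clause once and asks a service for a successor of every domain element. Its only rule
is guarded by the absence of the nullary fact `haltAtom`, which is derived once a value of `u` at
`n` is found.

In the canonical run the service answers `x + 1`, so the derived facts are true statements about ℕ
(`valid_canonicalRun`), and every true evaluation fact is eventually derived
(`ClosedUnder.evalAtom_mem`). Hence `haltAtom` appears there iff `u` is defined at `n`. If it never
appears, the canonical run goes on forever and its domain grows without bound.

If it appears at stage `T`, all other runs must be controlled too, although their services may
identify values or give one element several successors. Since the clauses are positive, stage `t` of
the canonical run maps homomorphically into every state reached after `t` steps (`exists_hom_next`).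
A nullary fact is fixed by homomorphisms, so every run stops after at most `T` steps. Each step at
most doubles the active domain, which gives a uniform bound.

Taking `u` universal leaves the clauses fixed and puts the varying code into the initial instance.
-/

theorem Atom.map_map {T U V : Type} (g : T → U) (h : U → V) (a : Atom T) :
    (a.map g).map h = a.map (h ∘ g) := by
  simp [Atom.map]

theorem Atom.map_congr {T U : Type} {g h : T → U} {a : Atom T} (H : ∀ x ∈ a.args, g x = h x) :
    a.map g = a.map h := by
  simpa [Atom.map] using H

theorem Atom.Conforms.map {T U : Type} {schema : List ℕ} {a : Atom T} (h : a.Conforms schema)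
    (g : T → U) : (a.map g).Conforms schema := by
  simpa [Atom.Conforms, Atom.map] using h

/-- A Horn clause without constants; the arguments of its atoms are variables. -/
structure Clause where
  body : List (Atom ℕ)
  head : Atom ℕ

def Clause.Conforms (schema : List ℕ) (c : Clause) : Prop :=
  (∀ b ∈ c.body, b.Conforms schema) ∧ c.head.Conforms schema

/-- Range restriction: the variables of the head occur in the body. -/
def Clause.Safe (c : Clause) : Prop := ∀ x ∈ c.head.args, ∃ b ∈ c.body, x ∈ b.args

/-- The effect specification adding the immediate consequences of a clause. -/
def Clause.effect (c : Clause) : Effect :=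
  ⟨⟨c.head.args, [c.body.map (Atom.map Term.var)]⟩, .tru,
    [c.head.map fun x => .plain (.var x)]⟩

abbrev haltAtom : Atom ℕ := ⟨0, []⟩
abbrev zeroAtom (x : ℕ) : Atom ℕ := ⟨1, [x]⟩
abbrev inputAtom (x : ℕ) : Atom ℕ := ⟨2, [x]⟩
abbrev domAtom (x : ℕ) : Atom ℕ := ⟨3, [x]⟩
abbrev succAtom (x y : ℕ) : Atom ℕ := ⟨4, [x, y]⟩
abbrev ltAtom (x y : ℕ) : Atom ℕ := ⟨5, [x, y]⟩
abbrev pairAtom (x y z : ℕ) : Atom ℕ := ⟨6, [x, y, z]⟩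

/-- `y` is a value of the function with code `c` at `x`. -/
abbrev evalAtom (c : Nat.Partrec.Code) (x y : ℕ) : Atom ℕ := ⟨Encodable.encode c + 7, [x, y]⟩

/-- Every element of the domain gets a successor, provided by a service call. -/
def growEffect : Effect :=
  ⟨⟨[0], [[⟨3, [.var 0]⟩]]⟩, .tru,
    [⟨3, [.call 0 [.var 0]]⟩, ⟨4, [.plain (.var 0), .call 0 [.var 0]]⟩]⟩

def clauseAction (P : List Clause) : Action := ⟨[], growEffect :: P.map Clause.effect⟩

/-- The system that applies the clauses and grows the domain as long as `haltAtom` is not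
derived. -/
def clauseSystem (schema : List ℕ) (init : List Fact) (P : List Clause) : System where
  schema := schema
  constraints := []
  init := init
  services := [1]
  actions := [clauseAction P]
  rules := [⟨.neg (.atom ⟨0, []⟩), 0⟩]

/-- The immediate consequences of `I`, when the successor of `x` is chosen to be `g x`. -/
def next (P : List Clause) (g : ℕ → ℕ) (I : Set Fact) : Set Fact :=
  {A | (∃ c ∈ P, ∃ w : ℕ → ℕ, (∀ b ∈ c.body, b.map w ∈ I) ∧ A = c.head.map w) ∨
    ∃ x, domAtom x ∈ I ∧ (A = domAtom (g x) ∨ A = succAtom x (g x))}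

/-- All filters are `tru` and there are no parameters, so an answer to an effect is an instantiation
of a clause body. The witness `w` for the existential variables agrees with the answer `v` only on
the head variables, which are the only ones the added fact uses. -/
theorem resolve_doEffects (P : List Clause) (I : Set Fact) (σ : ℕ → ℕ) (θ : ℕ → List ℕ → ℕ) :
    Atom.map (CallTerm.resolve θ) '' (clauseAction P).doEffects I σ =
      next P (fun x => θ 0 [x]) I := by
  have hterm : (Term.eval · ∘ Term.var) = (id : (ℕ → ℕ) → ℕ → ℕ) := rfl
  ext A
  simp only [Set.mem_image, Action.doEffects, clauseAction, List.mem_cons, List.mem_map,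
    Set.mem_ofPred_eq, next]
  constructor
  · rintro ⟨_, ⟨e, rfl | ⟨c, hc, rfl⟩, v, -, ⟨d, hd, w, hw, hb⟩, -, a, ha, rfl⟩, rfl⟩
    · right
      have hd : d = [⟨3, [.var 0]⟩] := by simpa [growEffect] using hd
      subst hd
      have h0 : w 0 = v 0 := hw 0 (by simp [growEffect])
      refine ⟨v 0, ?_, ?_⟩
      · rw [← h0]
        exact hb _ (List.mem_singleton.2 rfl)
      · simp only [growEffect, List.mem_cons, List.not_mem_nil, or_false] at ha
        rcases ha with rfl | rfl
        · exact Or.inl rfl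
        · exact Or.inr rfl
    · left
      have hd : d = c.body.map (Atom.map Term.var) := by simpa [Clause.effect] using hd
      have ha : a = c.head.map fun x => .plain (.var x) := by simpa [Clause.effect] using ha
      subst hd ha
      refine ⟨c, hc, w, fun b hbc => ?_, ?_⟩
      · have := hb _ (List.mem_map_of_mem hbc)
        rwa [Atom.map_map] at this
      · rw [Atom.map_map, Atom.map_map]
        exact Atom.map_congr fun x hx => (hw x (Or.inl hx)).symm
  · rintro (⟨c, hc, w, hb, rfl⟩ | ⟨x, hx, hA⟩)
    · refine ⟨_, ⟨c.effect, Or.inr ⟨c, hc, rfl⟩, w, by simp, ⟨_, List.mem_singleton.2 rfl, w,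
        fun _ _ => rfl, ?_⟩, trivial, _, List.mem_singleton.2 rfl, rfl⟩, ?_⟩
      · intro a ha
        obtain ⟨b, hbc, rfl⟩ := List.mem_map.1 ha
        rw [Atom.map_map]
        exact hb b hbc
      · rw [Atom.map_map, Atom.map_map]
        rfl
    · have hs : growEffect.pos.Sat [] I fun _ => x :=
        ⟨_, List.mem_singleton.2 rfl, fun _ => x, fun _ _ => rfl, by
          intro a ha
          rw [List.mem_singleton.1 ha]
          exact hx⟩
      rcases hA with rfl | rfl
      · exact ⟨_, ⟨growEffect, Or.inl rfl, fun _ => x, by simp, hs, trivial,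
          ⟨3, [.call 0 [.var 0]]⟩, by simp [growEffect], rfl⟩, rfl⟩
      · exact ⟨_, ⟨growEffect, Or.inl rfl, fun _ => x, by simp, hs, trivial,
          ⟨4, [.plain (.var 0), .call 0 [.var 0]]⟩, by simp [growEffect], rfl⟩, rfl⟩

theorem clauseSystem_step_iff {schema : List ℕ} {init : List Fact} {P : List Clause}
    {I I' : Set Fact} :
    (clauseSystem schema init P).Step I I' ↔ haltAtom ∉ I ∧ ∃ g, I' = next P g I := by
  constructor
  · rintro ⟨r, hr, α, hα, σ, hg, θ, rfl, -⟩
    obtain rfl := List.mem_singleton.1 hr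
    obtain rfl : clauseAction P = α := by simpa [clauseSystem] using hα
    exact ⟨hg.2, _, resolve_doEffects P I σ θ⟩
  · rintro ⟨hI, g, rfl⟩
    refine ⟨_, List.mem_singleton.2 rfl, clauseAction P, rfl, fun _ => 0,
      -- The only service is called with exactly one argument, so the default of `headD` is never
      -- used.
      ⟨fun _ _ => Set.mem_univ _, hI⟩, fun _ args => g (args.headD 0), ?_, ?_⟩
    · rw [resolve_doEffects]
      rfl
    · simp [clauseSystem]

/-- No query or effect mentions a constant and there are no constraints. What remains are the
arities and, through `Safe`, the occurrence of each head variable in the body. -/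
theorem clauseSystem_isDCDS {schema : List ℕ} {init : List Fact} {P : List Clause}
    (h0 : schema[0]? = some 0) (h3 : schema[3]? = some 1) (h4 : schema[4]? = some 2)
    (hinit : ∀ f ∈ init, f.Conforms schema) (hP : ∀ c ∈ P, c.Conforms schema)
    (hs : ∀ c ∈ P, c.Safe) : (clauseSystem schema init P).IsDCDS where
  init_conforms := hinit
  constraints_wf := by simp [clauseSystem]
  init_sat := by simp [clauseSystem]
  actions_wf := by
    intro α hα
    obtain rfl := List.mem_singleton.1 hα
    refine ⟨List.nodup_nil, fun e he => ?_⟩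
    simp only [clauseAction, List.mem_cons, List.mem_map] at he
    rcases he with rfl | ⟨c, hc, rfl⟩
    · simp [growEffect, Effect.WellFormed, UCQ.WellFormed, Atom.Conforms, clauseSystem,
        Formula.Conforms, Formula.consts, Formula.fv, Term.consts, Term.vars, clauseAction,
        CallTerm.terms, h3, h4]
    · refine ⟨⟨by simp [clauseAction], ?_⟩, ⟨trivial, by simp [Clause.effect, Formula.consts],
        by simp [Clause.effect, Formula.fv]⟩, ?_⟩
      · intro d hd
        obtain rfl := List.mem_singleton.1 hd
        refine ⟨fun a ha => ?_, fun x hx => ?_⟩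
        · obtain ⟨b, hb, rfl⟩ := List.mem_map.1 ha
          refine ⟨((hP c hc).1 b hb).map _, fun t ht => ?_⟩
          obtain ⟨y, -, rfl⟩ := List.mem_map.1 ht
          exact Set.empty_subset _
        · obtain ⟨b, hb, hx⟩ := hs c hc x hx
          exact ⟨_, List.mem_map_of_mem hb, .var x, List.mem_map_of_mem hx, rfl⟩
      · intro a ha
        obtain rfl := List.mem_singleton.1 ha
        refine ⟨(hP c hc).2.map _, fun u hu => ?_⟩
        obtain ⟨y, hy, rfl⟩ := List.mem_map.1 hu
        refine ⟨fun t ht => ?_, fun f args h => by cases h⟩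
        obtain rfl := List.mem_singleton.1 ht
        refine ⟨Set.empty_subset _, ?_⟩
        rintro z rfl
        exact Or.inl hy
  rules_wf := by
    intro r hr
    obtain rfl := List.mem_singleton.1 hr
    exact ⟨h0, by simp [Formula.consts], clauseAction P, rfl, by simp [Formula.fv, clauseAction]⟩

/-! ### Persistence of facts and growth of the active domain -/

/-- The clauses copying all facts over the schema. -/
def copyClauses (schema : List ℕ) : List Clause :=
  (List.range schema.length).map fun i =>
    ⟨[⟨i, List.range (schema.getD i 0)⟩], ⟨i, List.range (schema.getD i 0)⟩⟩

/-- A step replaces the instance instead of extending it; the copy clauses are what makes the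
process inflationary. -/
theorem mem_next_of_mem {schema : List ℕ} {P : List Clause} (hP : copyClauses schema ⊆ P)
    {g : ℕ → ℕ} {I : Set Fact} {A : Fact} (hA : A ∈ I) (hc : A.Conforms schema) :
    A ∈ next P g I := by
  have hlt : A.rel < schema.length := (List.getElem?_eq_some_iff.1 hc).1
  have hlen : schema.getD A.rel 0 = A.args.length := by
    rw [List.getD_eq_getElem?_getD, hc]; rfl
  have hmap : (⟨A.rel, List.range (schema.getD A.rel 0)⟩ : Atom ℕ).map
      (fun j => A.args.getD j 0) = A := by
    obtain ⟨r, l⟩ := A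
    simp only [hlen, Atom.map, Atom.mk.injEq, true_and]
    apply List.ext_getElem <;> simp
    intro i h1
    simp [h1]
  refine Or.inl ⟨_, hP (List.mem_map_of_mem (List.mem_range.2 hlt)), fun j => A.args.getD j 0,
    ?_, hmap.symm⟩
  intro b hb
  rw [List.mem_singleton.1 hb, hmap]
  exact hA

/-- By range restriction clauses create no values. Within one step the service is a function, so
each old element contributes at most one new value. -/
theorem adom_next_subset {P : List Clause} (hs : ∀ c ∈ P, c.Safe) (g : ℕ → ℕ) (I : Set Fact) :
    adom (next P g I) ⊆ adom I ∪ g '' adom I := by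
  rintro z ⟨A, ⟨c, hc, w, hb, rfl⟩ | ⟨x, hx, rfl | rfl⟩, hz⟩
  · obtain ⟨y, hy, rfl⟩ := List.mem_map.1 hz
    obtain ⟨b, hbc, hyb⟩ := hs c hc y hy
    exact Or.inl ⟨_, hb b hbc, List.mem_map_of_mem hyb⟩
  · obtain rfl := List.mem_singleton.1 hz
    exact Or.inr ⟨x, ⟨_, hx, List.mem_singleton.2 rfl⟩, rfl⟩
  · have hxa : x ∈ adom I := ⟨_, hx, List.mem_singleton.2 rfl⟩
    rcases List.mem_cons.1 hz with rfl | hz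
    · exact Or.inl hxa
    · obtain rfl := List.mem_singleton.1 hz
      exact Or.inr ⟨x, hxa, rfl⟩

theorem encard_adom_next_le {P : List Clause} (hs : ∀ c ∈ P, c.Safe) (g : ℕ → ℕ) (I : Set Fact) :
    (adom (next P g I)).encard ≤ 2 * (adom I).encard := by
  calc _ ≤ _ := Set.encard_mono (adom_next_subset hs g I)
    _ ≤ _ := Set.encard_union_le _ _
    _ ≤ (adom I).encard + (adom I).encard := by gcongr _ + ?_; exact Set.encard_image_le _ _
    _ = _ := (two_mul _).symm

theorem adom_finite {I : Set Fact} (hI : I.Finite) : (adom I).Finite := by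
  have : adom I = ⋃ f ∈ I, {c | c ∈ f.args} := by ext; simp [adom]
  rw [this]
  exact hI.biUnion fun f _ => f.args.finite_toSet

/-! ### The canonical run on the natural numbers -/

/-- The natural numbers up to `n` with their order structure, and the input `n`. -/
def chainInit (n : ℕ) : List Fact :=
  zeroAtom 0 :: inputAtom n ::
    ((List.range (n + 1)).map domAtom ++ (List.range n).map fun i => succAtom i (i + 1))

theorem mem_chainInit {n : ℕ} {A : Fact} : A ∈ chainInit n ↔
    A = zeroAtom 0 ∨ A = inputAtom n ∨ (∃ i ≤ n, A = domAtom i) ∨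
      ∃ i < n, A = succAtom i (i + 1) := by
  simp [chainInit, eq_comm]

/-- The run in which the service maps each number to its successor. -/
def canonicalRun (P : List Clause) (n : ℕ) : ℕ → Set Fact
  | 0 => {A | A ∈ chainInit n}
  | t + 1 => next P Nat.succ (canonicalRun P n t)

section Run

variable {schema : List ℕ} {P : List Clause}

theorem canonicalRun_conforms (h3 : schema[3]? = some 1) (h4 : schema[4]? = some 2) {n : ℕ}
    (hinit : ∀ A ∈ chainInit n, A.Conforms schema) (hP : ∀ c ∈ P, c.Conforms schema) (t : ℕ) :
    ∀ A ∈ canonicalRun P n t, A.Conforms schema := by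
  induction t with
  | zero => exact hinit
  | succ t ih =>
    rintro A (⟨c, hc, w, hb, rfl⟩ | ⟨x, hx, rfl | rfl⟩)
    · exact (hP c hc).2.map w
    · exact h3
    · exact h4

theorem canonicalRun_mono (hcopy : copyClauses schema ⊆ P) {n : ℕ}
    (hconf : ∀ t, ∀ A ∈ canonicalRun P n t, A.Conforms schema) : Monotone (canonicalRun P n) :=
  monotone_nat_of_le_succ fun t _ hA => mem_next_of_mem hcopy hA (hconf t _ hA)

/-- This makes `n + t + 1` fresh at stage `t`, which leaves a homomorphism free to choose its image
there. -/
theorem canonicalRun_le (hs : ∀ c ∈ P, c.Safe) {n : ℕ} (t : ℕ) :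
    ∀ A ∈ canonicalRun P n t, ∀ x ∈ A.args, x ≤ n + t := by
  suffices H : adom (canonicalRun P n t) ⊆ Set.Iic (n + t) from
    fun A hA x hx => H ⟨A, hA, hx⟩
  induction t with
  | zero =>
    rintro x ⟨A, hA, hx⟩
    rcases mem_chainInit.1 hA with rfl | rfl | ⟨i, hi, rfl⟩ | ⟨i, hi, rfl⟩ <;>
      simp at hx ⊢ <;> omega
  | succ t ih =>
    refine (adom_next_subset hs _ _).trans ?_
    rintro x (hx | ⟨y, hy, rfl⟩)
    · exact (ih hx).trans (Nat.le_succ _)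
    · exact Nat.succ_le_succ (ih hy)

theorem domAtom_mem_canonicalRun (hcopy : copyClauses schema ⊆ P) {n : ℕ}
    (hconf : ∀ t, ∀ A ∈ canonicalRun P n t, A.Conforms schema) (t : ℕ) :
    ∀ i ≤ n + t, domAtom i ∈ canonicalRun P n t := by
  induction t with
  | zero => exact fun i hi => mem_chainInit.2 (Or.inr (Or.inr (Or.inl ⟨i, hi, rfl⟩)))
  | succ t ih =>
    intro i hi
    rcases Nat.lt_or_ge (n + t) i with h | h
    · obtain rfl : i = n + t + 1 := by omega
      exact Or.inr ⟨n + t, ih _ le_rfl, Or.inl rfl⟩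
    · exact canonicalRun_mono hcopy hconf t.le_succ (ih i h)

theorem succAtom_mem_canonicalRun (hcopy : copyClauses schema ⊆ P) {n : ℕ}
    (hconf : ∀ t, ∀ A ∈ canonicalRun P n t, A.Conforms schema) (t : ℕ) :
    ∀ i < n + t, succAtom i (i + 1) ∈ canonicalRun P n t := by
  induction t with
  | zero => exact fun i hi => mem_chainInit.2 (Or.inr (Or.inr (Or.inr ⟨i, hi, rfl⟩)))
  | succ t ih =>
    intro i hi
    exact Or.inr ⟨i, domAtom_mem_canonicalRun hcopy hconf t i (by omega), Or.inr rfl⟩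

/-! ### Homomorphisms from the canonical run, and state-boundedness -/

/-- Every step of the system preserves homomorphisms from the canonical run, whatever the services
answer. -/
theorem exists_hom_next (hcopy : copyClauses schema ⊆ P) (hs : ∀ c ∈ P, c.Safe) {n : ℕ}
    (hconf : ∀ t, ∀ A ∈ canonicalRun P n t, A.Conforms schema) {t : ℕ} {I : Set Fact}
    (g : ℕ → ℕ) (h : ∃ e : ℕ → ℕ, ∀ A ∈ canonicalRun P n t, A.map e ∈ I) :
    ∃ e : ℕ → ℕ, ∀ A ∈ canonicalRun P n (t + 1), A.map e ∈ next P g I := by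
  obtain ⟨e, he⟩ := h
  -- The only value that stage `t + 1` adds is `n + t + 1`, the successor of `n + t`; its image has
  -- to be the service's answer at the image of `n + t`.
  set e' := Function.update e (n + t + 1) (g (e (n + t))) with he'
  have hne : ∀ x ≤ n + t, e' x = e x := fun x hx => Function.update_of_ne (by omega) _ _
  have hnew : e' (n + t + 1) = g (e (n + t)) := Function.update_self _ _ _
  have hI : ∀ A ∈ canonicalRun P n t, A.map e' ∈ I := fun A hA => by
    rw [Atom.map_congr fun x hx => hne x (canonicalRun_le hs t A hA x hx)]
    exact he A hA
  have hold : ∀ A ∈ canonicalRun P n t, A.map e' ∈ next P g I := fun A hA =>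
    mem_next_of_mem hcopy (hI A hA) ((hconf t A hA).map e')
  refine ⟨e', ?_⟩
  rintro A (⟨c, hc, w, hb, rfl⟩ | ⟨x, hx, hA⟩)
  · rw [Atom.map_map]
    refine Or.inl ⟨c, hc, e' ∘ w, fun b hbc => ?_, rfl⟩
    rw [← Atom.map_map]
    exact hI _ (hb b hbc)
  · have hxle : x ≤ n + t := canonicalRun_le hs t _ hx x (List.mem_singleton.2 rfl)
    -- For `x < n + t` the answer `g (e x)` need not be `e (x + 1)`, since the service may now
    -- answer differently. The facts about `x` are already present at stage `t`, however, and are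
    -- copied.
    rcases hxle.lt_or_eq with hlt | rfl
    · rcases hA with rfl | rfl
      · exact hold _ (domAtom_mem_canonicalRun hcopy hconf t _ hlt)
      · exact hold _ (succAtom_mem_canonicalRun hcopy hconf t _ hlt)
    · refine Or.inr ⟨e (n + t), he _ hx, ?_⟩
      rcases hA with rfl | rfl
      · exact Or.inl (by simp [Atom.map, hnew])
      · exact Or.inr (by simp [Atom.map, hnew, hne])

/-- The invariant along an arbitrary run: after `t` steps the state receives a homomorphism from
canonical stage `t` and has at most `2 ^ t * k` values, where `k` counts the initial ones. -/
theorem stateBounded_of_haltAtom_mem (hcopy : copyClauses schema ⊆ P) (hs : ∀ c ∈ P, c.Safe)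
    {n : ℕ} (hconf : ∀ t, ∀ A ∈ canonicalRun P n t, A.Conforms schema) {T : ℕ}
    (hT : haltAtom ∈ canonicalRun P n T) :
    (clauseSystem schema (chainInit n) P).StateBounded := by
  have hfin : (adom {A | A ∈ chainInit n}).Finite := adom_finite (List.finite_toSet _)
  obtain ⟨k, hk⟩ := ENat.ne_top_iff_exists.1 hfin.encard_lt_top.ne
  refine ⟨2 ^ T * k + 1, fun I hI => ?_⟩
  have key : ∃ t ≤ T, (∃ e : ℕ → ℕ, ∀ A ∈ canonicalRun P n t, A.map e ∈ I) ∧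
      (adom I).encard ≤ (2 ^ t * k : ℕ) := by
    induction hI with
    | refl =>
      refine ⟨0, Nat.zero_le _, ⟨id, fun A hA => ?_⟩, ?_⟩
      · have : A.map id = A := by simp [Atom.map]
        rwa [this]
      · rw [pow_zero, one_mul, hk]
        exact le_rfl
    | tail _ hstep ih =>
      obtain ⟨t, ht, he, hcard⟩ := ih
      obtain ⟨hhalt, g, rfl⟩ := clauseSystem_step_iff.1 hstep
      -- At `t = T` the homomorphism would put `haltAtom` into the current state, where the guard
      -- then forbids the step just taken.
      have hlt : t < T := ht.lt_of_ne fun h => by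
        obtain ⟨e, he⟩ := he
        exact hhalt (he haltAtom (h ▸ hT))
      refine ⟨t + 1, hlt, exists_hom_next hcopy hs hconf g he,
        (encard_adom_next_le hs g _).trans ?_⟩
      calc _ ≤ 2 * ((2 ^ t * k : ℕ) : ℕ∞) := by gcongr
        _ = _ := by push_cast; ring
  obtain ⟨t, ht, -, hcard⟩ := key
  have h1 : 2 ^ t * k < 2 ^ T * k + 1 :=
    Nat.lt_succ_of_le (Nat.mul_le_mul_right k (Nat.pow_le_pow_right (by norm_num) ht))
  exact hcard.trans_lt (by exact_mod_cast h1)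

/-- The guard never fails along the canonical run, so all its stages are states; stage `b` already
has at least `b` values. -/
theorem not_stateBounded_of_haltAtom_notMem (hcopy : copyClauses schema ⊆ P) {n : ℕ}
    (hconf : ∀ t, ∀ A ∈ canonicalRun P n t, A.Conforms schema)
    (hT : ∀ t, haltAtom ∉ canonicalRun P n t) :
    ¬ (clauseSystem schema (chainInit n) P).StateBounded := by
  rintro ⟨b, hb⟩
  have hstate : ∀ t, (clauseSystem schema (chainInit n) P).IsState (canonicalRun P n t) := by
    intro t
    induction t with
    | zero => exact Relation.ReflTransGen.refl
    | succ t ih => exact ih.tail (clauseSystem_step_iff.2 ⟨hT t, _, rfl⟩)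
  have hsub : ((Finset.range b : Finset ℕ) : Set ℕ) ⊆ adom (canonicalRun P n b) := fun i hi =>
    ⟨_, domAtom_mem_canonicalRun hcopy hconf b i
      (by have := Finset.mem_range.1 (Finset.mem_coe.1 hi); omega), List.mem_singleton.2 rfl⟩
  have hle := Set.encard_mono hsub
  rw [Set.encard_coe_eq_coe_finsetCard, Finset.card_range] at hle
  exact (hb _ (hstate b)).not_ge hle

end Run

/-! ### A positive program evaluating partial recursive functions -/

open Nat.Partrec (Code)

/-- The search starts at `m` and returns the position reached, not the offset. Nonzero values are
written `v + 1` so that a positive successor fact can express them. -/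
theorem mem_eval_rfind' {f : Code} {a m y : ℕ} :
    y ∈ (Code.rfind' f).eval (Nat.pair a m) ↔
      ∃ d, y = d + m ∧ 0 ∈ f.eval (Nat.pair a (d + m)) ∧
        ∀ j < d, ∃ v, v + 1 ∈ f.eval (Nat.pair a (j + m)) := by
  simp only [Code.eval, Nat.unpaired, Nat.unpair_pair, Part.mem_map_iff]
  constructor
  · rintro ⟨d, hd, rfl⟩
    obtain ⟨h0, hj⟩ := Nat.mem_rfind.1 hd
    refine ⟨d, rfl, by simpa using h0, fun j hjd => ?_⟩
    obtain ⟨v, hv, hv0⟩ := by simpa using hj hjd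
    exact ⟨v - 1, by rwa [Nat.sub_add_cancel (Nat.pos_of_ne_zero hv0)]⟩
  · rintro ⟨d, rfl, h0, hj⟩
    refine ⟨d, Nat.mem_rfind.2 ⟨by simpa using h0, fun {j} hjd => ?_⟩, rfl⟩
    obtain ⟨v, hv⟩ := hj j hjd
    simpa using ⟨v + 1, hv, Nat.succ_ne_zero v⟩

theorem mem_eval_rfind'_of_zero {f : Code} {a m : ℕ} (h : 0 ∈ f.eval (Nat.pair a m)) :
    m ∈ (Code.rfind' f).eval (Nat.pair a m) :=
  mem_eval_rfind'.2 ⟨0, by simp, by simpa using h, by simp⟩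

/-- Because the result is an absolute position, a search that moves on from `m` has the same result
as the one started at `m + 1`. -/
theorem mem_eval_rfind'_of_succ {f : Code} {a m v y : ℕ} (hv : v + 1 ∈ f.eval (Nat.pair a m))
    (h : y ∈ (Code.rfind' f).eval (Nat.pair a (m + 1))) :
    y ∈ (Code.rfind' f).eval (Nat.pair a m) := by
  obtain ⟨d, rfl, h0, hj⟩ := mem_eval_rfind'.1 h
  refine mem_eval_rfind'.2 ⟨d + 1, by ring, ?_, ?_⟩
  · rwa [add_assoc, add_comm 1 m]
  · rintro (_ | j) hjd
    · exact ⟨v, by simpa using hv⟩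
    · obtain ⟨w, hw⟩ := hj j (by omega)
      exact ⟨w, by rwa [add_assoc, add_comm 1 m]⟩

theorem mem_eval_prec_zero {f g : Code} {a y : ℕ} :
    y ∈ (Code.prec f g).eval (Nat.pair a 0) ↔ y ∈ f.eval a := by
  rw [Code.eval_prec_zero]

theorem mem_eval_prec_succ {f g : Code} {a k y : ℕ} :
    y ∈ (Code.prec f g).eval (Nat.pair a (k + 1)) ↔
      ∃ i ∈ (Code.prec f g).eval (Nat.pair a k), y ∈ g.eval (Nat.pair a (Nat.pair k i)) := by
  rw [← Nat.succ_eq_add_one, Code.eval_prec_succ]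
  exact Part.mem_bind_iff

theorem mem_eval_comp {f g : Code} {x z : ℕ} :
    z ∈ (Code.comp f g).eval x ↔ ∃ y ∈ g.eval x, z ∈ f.eval y :=
  Part.mem_bind_iff

theorem mem_eval_pair {f g : Code} {x z : ℕ} :
    z ∈ (Code.pair f g).eval x ↔ ∃ a ∈ f.eval x, ∃ b ∈ g.eval x, Nat.pair a b = z := by
  simp [Code.eval, Seq.seq]

/-- The clauses for the order and for the pairing function, which is enumerated along its values,
and the clause that recognizes that the function with code `u` is defined at the input. -/
def baseClauses (u : Code) : List Clause :=
  [⟨[succAtom 0 1], ltAtom 0 1⟩,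
   ⟨[ltAtom 0 1, succAtom 1 2], ltAtom 0 2⟩,
   ⟨[zeroAtom 0], pairAtom 0 0 0⟩,
   -- The next four clauses go from the pair with value `c` to the pair with value `c + 1`. The
   -- values of `Nat.pair` run through `(0, b), …, (b - 1, b)`, then `(b, 0), …, (b, b)`, then `(0,
   -- b + 1)`.
   ⟨[pairAtom 0 1 2, succAtom 2 3, succAtom 0 4, ltAtom 4 1], pairAtom 4 1 3⟩,
   ⟨[pairAtom 0 1 2, succAtom 2 3, succAtom 0 1, zeroAtom 4], pairAtom 1 4 3⟩,
   ⟨[pairAtom 0 1 2, succAtom 2 3, succAtom 1 4, ltAtom 1 0], pairAtom 0 4 3⟩,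
   ⟨[pairAtom 0 0 2, succAtom 2 3, succAtom 0 4, zeroAtom 5], pairAtom 5 4 3⟩,
   ⟨[inputAtom 0, evalAtom u 0 1], haltAtom⟩]

/-- The clauses for the values of the function with a given code in terms of its subcodes. -/
def codeClauses : Code → List Clause
  | .zero => [⟨[domAtom 0, zeroAtom 1], evalAtom .zero 0 1⟩]
  | .succ => [⟨[succAtom 0 1], evalAtom .succ 0 1⟩]
  | .left => [⟨[pairAtom 0 1 2], evalAtom .left 2 0⟩]
  | .right => [⟨[pairAtom 0 1 2], evalAtom .right 2 1⟩]
  | .pair f g => [⟨[evalAtom f 0 1, evalAtom g 0 2, pairAtom 1 2 3], evalAtom (.pair f g) 0 3⟩]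
  | .comp f g => [⟨[evalAtom g 0 1, evalAtom f 1 2], evalAtom (.comp f g) 0 2⟩]
  | .prec f g =>
    [⟨[zeroAtom 1, pairAtom 0 1 2, evalAtom f 0 3], evalAtom (.prec f g) 2 3⟩,
     ⟨[pairAtom 0 1 2, evalAtom (.prec f g) 2 3, succAtom 1 4, pairAtom 1 3 5, pairAtom 0 5 6,
        evalAtom g 6 7, pairAtom 0 4 8], evalAtom (.prec f g) 8 7⟩]
  | .rfind' f =>
    [⟨[pairAtom 0 1 2, evalAtom f 2 3, zeroAtom 3], evalAtom (.rfind' f) 2 1⟩,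
     -- Variable `4` is a predecessor of the value `3`; this says without negation that the value is
     -- nonzero.
     ⟨[pairAtom 0 1 2, evalAtom f 2 3, succAtom 4 3, succAtom 1 5, pairAtom 0 5 6,
        evalAtom (.rfind' f) 6 7], evalAtom (.rfind' f) 2 7⟩]

/-- The relations of the base clauses, and one binary relation for each code up to that of `u`. -/
def evalSchema (u : Code) : List ℕ :=
  [0, 1, 1, 1, 2, 2, 3] ++ List.replicate (Encodable.encode u + 1) 2

/-- Subcodes have smaller numbers, so the codes up to that of `u` are closed under subcodes and
finitely many clauses suffice; clauses for unrelated codes do no harm. -/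
def evalProgram (u : Code) : List Clause :=
  copyClauses (evalSchema u) ++ (baseClauses u ++
    (List.range (Encodable.encode u + 1)).flatMap fun i => codeClauses (Denumerable.ofNat Code i))

theorem mem_evalProgram {u : Code} {c : Clause} : c ∈ evalProgram u ↔
    c ∈ copyClauses (evalSchema u) ∨ c ∈ baseClauses u ∨
      ∃ d, Encodable.encode d ≤ Encodable.encode u ∧ c ∈ codeClauses d := by
  simp only [evalProgram, List.mem_append, List.mem_flatMap, List.mem_range, Nat.lt_succ_iff]
  refine or_congr_right (or_congr_right ⟨?_, ?_⟩)
  · rintro ⟨i, hi, hc⟩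
    exact ⟨_, by rwa [Denumerable.encode_ofNat], hc⟩
  · rintro ⟨d, hd, hc⟩
    exact ⟨_, hd, by rwa [Denumerable.ofNat_encode]⟩

theorem evalAtom_conforms {u c : Code} (h : Encodable.encode c ≤ Encodable.encode u) (x y : ℕ) :
    (evalAtom c x y).Conforms (evalSchema u) := by
  have h7 : (evalSchema u)[Encodable.encode c + 7]? =
      (List.replicate (Encodable.encode u + 1) 2)[Encodable.encode c]? := rfl
  rw [Atom.Conforms, h7, List.getElem?_replicate_of_lt (Nat.lt_succ_of_le h)]
  rfl

theorem codeClauses_conforms {u d : Code} (hd : Encodable.encode d ≤ Encodable.encode u) :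
    ∀ c ∈ codeClauses d, c.Conforms (evalSchema u) := by
  have key : ∀ {e : Code}, Encodable.encode e < Encodable.encode d → ∀ x y,
      (evalAtom e x y).Conforms (evalSchema u) := fun h => evalAtom_conforms (h.le.trans hd)
  have hself := evalAtom_conforms hd
  have hz : ∀ x, (zeroAtom x).Conforms (evalSchema u) := fun _ => rfl
  have hD : ∀ x, (domAtom x).Conforms (evalSchema u) := fun _ => rfl
  have hS : ∀ x y, (succAtom x y).Conforms (evalSchema u) := fun _ _ => rfl
  have hp : ∀ x y z, (pairAtom x y z).Conforms (evalSchema u) := fun _ _ _ => rfl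
  cases d with
  | zero | succ | left | right => simp [codeClauses, Clause.Conforms, *]
  | pair f g =>
    have h1 := key (Code.encode_lt_pair f g).1
    have h2 := key (Code.encode_lt_pair f g).2
    simp [codeClauses, Clause.Conforms, *]
  | comp f g =>
    have h1 := key (Code.encode_lt_comp f g).1
    have h2 := key (Code.encode_lt_comp f g).2
    simp [codeClauses, Clause.Conforms, *]
  | prec f g =>
    have h1 := key (Code.encode_lt_prec f g).1
    have h2 := key (Code.encode_lt_prec f g).2
    simp [codeClauses, Clause.Conforms, *]
  | rfind' f =>
    have h1 := key (Code.encode_lt_rfind' f)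
    simp [codeClauses, Clause.Conforms, *]

theorem evalProgram_conforms (u : Code) : ∀ c ∈ evalProgram u, c.Conforms (evalSchema u) := by
  intro c hc
  rcases mem_evalProgram.1 hc with hc | hc | ⟨d, hd, hc⟩
  · obtain ⟨i, hi, rfl⟩ := List.mem_map.1 hc
    have hi := List.mem_range.1 hi
    have : (⟨i, List.range ((evalSchema u).getD i 0)⟩ : Atom ℕ).Conforms (evalSchema u) := by
      simp [Atom.Conforms, List.getD_eq_getElem?_getD, List.getElem?_eq_getElem hi]
    exact ⟨fun b hb => List.mem_singleton.1 hb ▸ this, this⟩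
  · have hu : (⟨Encodable.encode u + 7, [0, 1]⟩ : Atom ℕ).Conforms (evalSchema u) :=
      evalAtom_conforms le_rfl 0 1
    have hu' : (⟨0, []⟩ : Atom ℕ).Conforms (evalSchema u) := rfl
    simp only [baseClauses, List.mem_cons, List.not_mem_nil, or_false] at hc
    rcases hc with rfl | rfl | rfl | rfl | rfl | rfl | rfl | rfl
    case inr.inr.inr.inr.inr.inr.inr =>
      refine ⟨?_, hu'⟩
      simp only [List.forall_mem_cons]
      exact ⟨rfl, hu, by simp⟩
    all_goals simp [Clause.Conforms, Atom.Conforms, evalSchema]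
  · exact codeClauses_conforms hd c hc

theorem evalProgram_safe (u : Code) : ∀ c ∈ evalProgram u, c.Safe := by
  intro c hc
  rcases mem_evalProgram.1 hc with hc | hc | ⟨d, -, hc⟩
  · obtain ⟨i, -, rfl⟩ := List.mem_map.1 hc
    exact fun x hx => ⟨_, List.mem_singleton.2 rfl, hx⟩
  · simp only [baseClauses, List.mem_cons, List.not_mem_nil, or_false] at hc
    rcases hc with rfl | rfl | rfl | rfl | rfl | rfl | rfl | rfl <;> simp [Clause.Safe]
  · cases d <;> simp only [codeClauses, List.mem_cons, List.not_mem_nil, or_false] at hc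
    case prec | rfind' => rcases hc with rfl | rfl <;> simp [Clause.Safe]
    all_goals subst hc; simp [Clause.Safe]

theorem chainInit_conforms (u : Code) (n : ℕ) :
    ∀ A ∈ chainInit n, A.Conforms (evalSchema u) := by
  intro A hA
  rcases mem_chainInit.1 hA with rfl | rfl | ⟨i, -, rfl⟩ | ⟨i, -, rfl⟩ <;> rfl

/-! ### Soundness -/

/-- The intended meaning of the relations over the natural numbers, for the input `n`. -/
def Valid (u : Code) (n : ℕ) : Fact → Prop
  | ⟨0, []⟩ => (u.eval n).Dom
  | ⟨1, [x]⟩ => x = 0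
  | ⟨2, [x]⟩ => x = n
  | ⟨3, [_]⟩ => True
  | ⟨4, [x, y]⟩ => y = x + 1
  | ⟨5, [x, y]⟩ => x < y
  | ⟨6, [x, y, z]⟩ => z = Nat.pair x y
  | ⟨i + 7, [x, y]⟩ => y ∈ (Denumerable.ofNat Code i).eval x
  | _ => False

section Valid

variable {u : Code} {n : ℕ}

@[simp] theorem valid_haltAtom : Valid u n haltAtom ↔ (u.eval n).Dom := Iff.rfl
@[simp] theorem valid_zeroAtom {x : ℕ} : Valid u n (zeroAtom x) ↔ x = 0 := Iff.rfl
@[simp] theorem valid_inputAtom {x : ℕ} : Valid u n (inputAtom x) ↔ x = n := Iff.rfl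
@[simp] theorem valid_domAtom {x : ℕ} : Valid u n (domAtom x) := trivial
@[simp] theorem valid_succAtom {x y : ℕ} : Valid u n (succAtom x y) ↔ y = x + 1 := Iff.rfl
@[simp] theorem valid_ltAtom {x y : ℕ} : Valid u n (ltAtom x y) ↔ x < y := Iff.rfl
@[simp] theorem valid_pairAtom {x y z : ℕ} :
    Valid u n (pairAtom x y z) ↔ z = Nat.pair x y := Iff.rfl
@[simp] theorem valid_evalAtom {c : Code} {x y : ℕ} :
    Valid u n (evalAtom c x y) ↔ y ∈ c.eval x := by
  change y ∈ (Denumerable.ofNat Code (Encodable.encode c)).eval x ↔ _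
  rw [Denumerable.ofNat_encode]

/-- In the pairing clauses the order hypotheses decide which branch of `Nat.pair` applies before and
after the move. -/
theorem valid_baseClauses : ∀ c ∈ baseClauses u, ∀ w : ℕ → ℕ,
    (∀ b ∈ c.body, Valid u n (b.map w)) → Valid u n (c.head.map w) := by
  intro c hc w
  simp only [baseClauses, List.mem_cons, List.not_mem_nil, or_false] at hc
  rcases hc with rfl | rfl | rfl | rfl | rfl | rfl | rfl | rfl <;>
    simp only [List.forall_mem_cons, Atom.map, List.map, valid_haltAtom, valid_zeroAtom,
      valid_inputAtom, valid_succAtom, valid_ltAtom, valid_pairAtom, valid_evalAtom]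
  · omega
  · omega
  · rintro ⟨h, -⟩
    rw [h]
    rfl
  · rintro ⟨h1, h2, h3, h4, -⟩
    rw [h2, h1, Nat.pair, Nat.pair, if_pos (by omega), if_pos (by omega)]
    omega
  · rintro ⟨h1, h2, h3, h4, -⟩
    rw [h2, h1, Nat.pair, Nat.pair, if_pos (by omega), if_neg (by omega), h3, h4]
    ring
  · rintro ⟨h1, h2, h3, h4, -⟩
    rw [h2, h1, Nat.pair, Nat.pair, if_neg (by omega), if_neg (by omega)]
    omega
  · rintro ⟨h1, h2, h3, h4, -⟩
    rw [h2, h1, Nat.pair, Nat.pair, if_neg (by omega), if_pos (by omega), h3, h4]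
    ring
  · rintro ⟨h1, h2, -⟩
    rw [h1] at h2
    exact h2.1

theorem valid_codeClauses {d : Code} : ∀ c ∈ codeClauses d, ∀ w : ℕ → ℕ,
    (∀ b ∈ c.body, Valid u n (b.map w)) → Valid u n (c.head.map w) := by
  intro c hc w
  cases d <;> simp only [codeClauses, List.mem_cons, List.not_mem_nil, or_false] at hc
  case prec =>
    rcases hc with rfl | rfl <;>
    simp only [List.forall_mem_cons, Atom.map, List.map, valid_zeroAtom,
      valid_succAtom, valid_pairAtom, valid_evalAtom]
    · rintro ⟨h1, h2, h3, -⟩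
      rw [h2, h1]
      exact mem_eval_prec_zero.2 h3
    · rintro ⟨h1, h2, h3, h4, h5, h6, h7, -⟩
      rw [h1] at h2
      rw [h5, h4] at h6
      rw [h7, h3]
      exact mem_eval_prec_succ.2 ⟨_, h2, h6⟩
  case rfind' =>
    rcases hc with rfl | rfl <;>
    simp only [List.forall_mem_cons, Atom.map, List.map, valid_zeroAtom,
      valid_succAtom, valid_pairAtom, valid_evalAtom]
    · rintro ⟨h1, h2, h3, -⟩
      rw [h1, h3] at h2
      rw [h1]
      exact mem_eval_rfind'_of_zero h2
    · rintro ⟨h1, h2, h3, h4, h5, h6, -⟩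
      rw [h1, h3] at h2
      rw [h5, h4] at h6
      rw [h1]
      exact mem_eval_rfind'_of_succ h2 h6
  all_goals
    subst hc
    simp only [List.forall_mem_cons, Atom.map, List.map, valid_zeroAtom, valid_domAtom,
      valid_succAtom, valid_pairAtom, valid_evalAtom]
  · simp +contextual [Code.eval, pure, PFun.pure]
  · simp +contextual [Code.eval]
  · simp +contextual [Code.eval]
  · simp +contextual [Code.eval]
  · rintro ⟨h1, h2, h3, -⟩
    exact mem_eval_pair.2 ⟨_, h1, _, h2, h3.symm⟩
  · rintro ⟨h1, h2, -⟩
    exact mem_eval_comp.2 ⟨_, h1, h2⟩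

end Valid

/-- Soundness is special to the canonical run: with other service answers false facts can be
derived, including an early `haltAtom`, which merely ends that run. -/
theorem valid_canonicalRun (u : Code) (n t : ℕ) :
    ∀ A ∈ canonicalRun (evalProgram u) n t, Valid u n A := by
  induction t with
  | zero =>
    intro A hA
    rcases mem_chainInit.1 hA with rfl | rfl | ⟨i, -, rfl⟩ | ⟨i, -, rfl⟩ <;> simp
  | succ t ih =>
    rintro A (⟨c, hc, w, hb, rfl⟩ | ⟨x, -, rfl | rfl⟩)
    · have hv : ∀ b ∈ c.body, Valid u n (b.map w) := fun b hbc => ih _ (hb b hbc)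
      rcases mem_evalProgram.1 hc with hc | hc | ⟨d, -, hc⟩
      · obtain ⟨i, -, rfl⟩ := List.mem_map.1 hc
        exact hv _ (List.mem_singleton.2 rfl)
      · exact valid_baseClauses c hc w hv
      · exact valid_codeClauses c hc w hv
    · simp
    · simp

/-! ### Completeness -/

/-- The set of facts is closed under the clauses. -/
def ClosedUnder (P : List Clause) (F : Set Fact) : Prop :=
  ∀ c ∈ P, ∀ w : ℕ → ℕ, (∀ b ∈ c.body, b.map w ∈ F) → c.head.map w ∈ F

section Closed

variable {u : Code} {F : Set Fact}

/-- Here `k` selects a clause and `l` lists the values of its variables in order. The lists supplied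
below cover all variables of the clause, so the default `0` plays no role. -/
theorem ClosedUnder.base_mem (hF : ClosedUnder (evalProgram u) F) (k : ℕ) (l : List ℕ)
    (hk : k < (baseClauses u).length)
    (h : ∀ b ∈ (baseClauses u)[k].body, b.map (fun i => l.getD i 0) ∈ F) :
    (baseClauses u)[k].head.map (fun i => l.getD i 0) ∈ F :=
  hF _ (mem_evalProgram.2 (Or.inr (Or.inl (List.getElem_mem hk)))) _ h

theorem ClosedUnder.code_mem (hF : ClosedUnder (evalProgram u) F) {d : Code}
    (hd : Encodable.encode d ≤ Encodable.encode u) (k : ℕ) (l : List ℕ)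
    (hk : k < (codeClauses d).length)
    (h : ∀ b ∈ (codeClauses d)[k].body, b.map (fun i => l.getD i 0) ∈ F) :
    (codeClauses d)[k].head.map (fun i => l.getD i 0) ∈ F :=
  hF _ (mem_evalProgram.2 (Or.inr (Or.inr ⟨d, hd, List.getElem_mem hk⟩))) _ h

theorem ClosedUnder.ltAtom_mem (hF : ClosedUnder (evalProgram u) F)
    (hsucc : ∀ i, succAtom i (i + 1) ∈ F) {a b : ℕ} (h : a < b) : ltAtom a b ∈ F := by
  induction b, h using Nat.le_induction with
  | base =>
    exact hF.base_mem 0 [a, a + 1] (by simp [baseClauses])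
      (by simpa [baseClauses, Atom.map] using hsucc a)
  | succ b _ ih =>
    exact hF.base_mem 1 [a, b, b + 1] (by simp [baseClauses])
      (by simpa [baseClauses, Atom.map] using ⟨ih, hsucc b⟩)

/-- The induction is on the value of the pair, following the enumeration: each case finds the pair
with the preceding value and applies the clause that leaves it. -/
theorem ClosedUnder.pairAtom_mem (hF : ClosedUnder (evalProgram u) F) (hzero : zeroAtom 0 ∈ F)
    (hsucc : ∀ i, succAtom i (i + 1) ∈ F) (a b : ℕ) : pairAtom a b (Nat.pair a b) ∈ F := by
  suffices H : ∀ c a b, Nat.pair a b = c → pairAtom a b c ∈ F from H _ a b rfl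
  intro c
  induction c with
  | zero =>
    intro a b h
    obtain ⟨rfl, rfl⟩ : a = 0 ∧ b = 0 := by
      have h1 := Nat.left_le_pair a b
      have h2 := Nat.right_le_pair a b
      omega
    exact hF.base_mem 2 [0] (by simp [baseClauses])
      (by simpa [baseClauses, Atom.map] using hzero)
  | succ c ih =>
    intro a b h
    rw [Nat.pair] at h
    split_ifs at h with hab
    · rcases a with _ | a
      · obtain ⟨b, rfl⟩ := Nat.exists_eq_succ_of_ne_zero hab.ne'
        have hp : pairAtom b b c ∈ F := by
          refine ih b b ?_
          rw [Nat.pair, if_neg (lt_irrefl b)]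
          have : (b + 1) * (b + 1) = b * b + b + b + 1 := by ring
          simp only [Nat.succ_eq_add_one] at h
          omega
        -- This clause has no variable `1`; the second entry is a filler.
        exact hF.base_mem 6 [b, 0, c, c + 1, b + 1, 0] (by simp [baseClauses])
          (by simpa [baseClauses, Atom.map] using ⟨hp, hsucc c, hsucc b, hzero⟩)
      · have hp : pairAtom a b c ∈ F := by
          refine ih a b ?_
          rw [Nat.pair, if_pos (by omega)]
          omega
        exact hF.base_mem 3 [a, b, c, c + 1, a + 1] (by simp [baseClauses])
          (by simpa [baseClauses, Atom.map] using
            ⟨hp, hsucc c, hsucc a, hF.ltAtom_mem hsucc hab⟩)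
    · rcases b with _ | b
      · have ha : a ≠ 0 := by
          rintro rfl
          simp at h
        obtain ⟨a, rfl⟩ := Nat.exists_eq_succ_of_ne_zero ha
        have hp : pairAtom a (a + 1) c ∈ F := by
          refine ih a (a + 1) ?_
          rw [Nat.pair, if_pos (by omega)]
          simp only [Nat.succ_eq_add_one] at h
          omega
        exact hF.base_mem 4 [a, a + 1, c, c + 1, 0] (by simp [baseClauses])
          (by simpa [baseClauses, Atom.map] using ⟨hp, hsucc c, hsucc a, hzero⟩)
      · have hp : pairAtom a b c ∈ F := by
          refine ih a b ?_
          rw [Nat.pair, if_neg (by omega)]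
          omega
        exact hF.base_mem 5 [a, b, c, c + 1, b + 1] (by simp [baseClauses])
          (by simpa [baseClauses, Atom.map] using
            ⟨hp, hsucc c, hsucc b, hF.ltAtom_mem hsucc (by omega)⟩)

/-- Structural induction on the code. Recursion needs an inner induction on the recursion argument,
and minimization one on the number of search steps left, with the starting point varying. -/
theorem ClosedUnder.evalAtom_mem (hF : ClosedUnder (evalProgram u) F) (hzero : zeroAtom 0 ∈ F)
    (hdom : ∀ i, domAtom i ∈ F) (hsucc : ∀ i, succAtom i (i + 1) ∈ F) (d : Code)
    (hd : Encodable.encode d ≤ Encodable.encode u) {x y : ℕ} (h : y ∈ d.eval x) :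
    evalAtom d x y ∈ F := by
  have hpair := hF.pairAtom_mem hzero hsucc
  induction d generalizing x y with
  | zero =>
    obtain rfl : y = 0 := by simpa [Code.eval, pure, PFun.pure] using h
    exact hF.code_mem hd 0 [x, 0] (by simp [codeClauses])
      (by simpa [codeClauses, Atom.map] using ⟨hdom x, hzero⟩)
  | succ =>
    obtain rfl : y = x + 1 := by simpa [Code.eval] using h
    exact hF.code_mem hd 0 [x, x + 1] (by simp [codeClauses])
      (by simpa [codeClauses, Atom.map] using hsucc x)
  | left =>
    obtain rfl : y = x.unpair.1 := by simpa [Code.eval] using h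
    exact hF.code_mem hd 0 [x.unpair.1, x.unpair.2, x] (by simp [codeClauses])
      (by simpa [codeClauses, Atom.map] using hpair x.unpair.1 x.unpair.2)
  | right =>
    obtain rfl : y = x.unpair.2 := by simpa [Code.eval] using h
    exact hF.code_mem hd 0 [x.unpair.1, x.unpair.2, x] (by simp [codeClauses])
      (by simpa [codeClauses, Atom.map] using hpair x.unpair.1 x.unpair.2)
  | pair f g ihf ihg =>
    have hlt := Code.encode_lt_pair f g
    obtain ⟨a, ha, b, hb, rfl⟩ := mem_eval_pair.1 h
    exact hF.code_mem hd 0 [x, a, b, Nat.pair a b] (by simp [codeClauses])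
      (by simpa [codeClauses, Atom.map] using
        ⟨ihf (hlt.1.le.trans hd) ha, ihg (hlt.2.le.trans hd) hb, hpair a b⟩)
  | comp f g ihf ihg =>
    have hlt := Code.encode_lt_comp f g
    obtain ⟨a, ha, hy⟩ := mem_eval_comp.1 h
    exact hF.code_mem hd 0 [x, a, y] (by simp [codeClauses])
      (by simpa [codeClauses, Atom.map] using
        ⟨ihg (hlt.2.le.trans hd) ha, ihf (hlt.1.le.trans hd) hy⟩)
  | prec f g ihf ihg =>
    have hlt := Code.encode_lt_prec f g
    obtain ⟨a, k, rfl⟩ : ∃ a k, x = Nat.pair a k := ⟨_, _, (Nat.pair_unpair x).symm⟩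
    induction k generalizing y with
    | zero =>
      exact hF.code_mem hd 0 [a, 0, Nat.pair a 0, y] (by simp [codeClauses])
        (by simpa [codeClauses, Atom.map] using
          ⟨hzero, hpair a 0, ihf (hlt.1.le.trans hd) (mem_eval_prec_zero.1 h)⟩)
    | succ k ih =>
      obtain ⟨i, hi, hy⟩ := mem_eval_prec_succ.1 h
      exact hF.code_mem hd 1 [a, k, Nat.pair a k, i, k + 1, Nat.pair k i,
          Nat.pair a (Nat.pair k i), y, Nat.pair a (k + 1)] (by simp [codeClauses])
        (by simpa [codeClauses, Atom.map] using
          ⟨hpair a k, ih hi, hsucc k, hpair k i, hpair a _, ihg (hlt.2.le.trans hd) hy,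
            hpair a (k + 1)⟩)
  | rfind' f ihf =>
    have hlt := Code.encode_lt_rfind' f
    obtain ⟨a, m, rfl⟩ : ∃ a m, x = Nat.pair a m := ⟨_, _, (Nat.pair_unpair x).symm⟩
    obtain ⟨k, hk, h0, hj⟩ := mem_eval_rfind'.1 h
    clear h
    induction k generalizing m with
    | zero =>
      obtain rfl : y = m := by omega
      rw [zero_add] at h0
      exact hF.code_mem hd 0 [a, y, Nat.pair a y, 0] (by simp [codeClauses])
        (by simpa [codeClauses, Atom.map] using
          ⟨hpair a y, ihf (hlt.le.trans hd) h0, hzero⟩)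
    | succ k ih =>
      obtain ⟨v, hv⟩ := hj 0 k.succ_pos
      rw [zero_add] at hv
      have hrec : evalAtom (.rfind' f) (Nat.pair a (m + 1)) y ∈ F := by
        refine ih (m + 1) (by omega) ?_ fun j hjk => ?_
        · rwa [← add_assoc, add_right_comm]
        · rw [← add_assoc, add_right_comm]
          exact hj (j + 1) (by omega)
      exact hF.code_mem hd 1 [a, m, Nat.pair a m, v + 1, v, m + 1, Nat.pair a (m + 1), y]
        (by simp [codeClauses])
        (by simpa [codeClauses, Atom.map] using
          ⟨hpair a m, ihf (hlt.le.trans hd) hv, hsucc v, hsucc m, hpair a (m + 1), hrec⟩)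

end Closed

theorem evalProgram_copy (u : Code) : copyClauses (evalSchema u) ⊆ evalProgram u :=
  List.subset_append_left _ _

theorem evalProgram_run_conforms (u : Code) (n t : ℕ) :
    ∀ A ∈ canonicalRun (evalProgram u) n t, A.Conforms (evalSchema u) :=
  canonicalRun_conforms rfl rfl (chainInit_conforms u n) (evalProgram_conforms u) t

/-- The facts that occur in the canonical run are closed under the clauses. -/
theorem closedUnder_iUnion_canonicalRun (u : Code) (n : ℕ) :
    ClosedUnder (evalProgram u) (⋃ t, canonicalRun (evalProgram u) n t) := by
  intro c hc w hb
  have hmono := canonicalRun_mono (evalProgram_copy u) (evalProgram_run_conforms u n)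
  -- The body is finite and the stages increase, so one stage contains all its instances.
  have hex : ∃ T, ∀ b ∈ c.body, b.map w ∈ canonicalRun (evalProgram u) n T := by
    generalize c.body = l at hb
    induction l with
    | nil => exact ⟨0, by simp⟩
    | cons b l ih =>
      obtain ⟨T, hT⟩ := ih fun b' hb' => hb b' (List.mem_cons_of_mem _ hb')
      obtain ⟨T', hT'⟩ := Set.mem_iUnion.1 (hb b List.mem_cons_self)
      refine ⟨max T T', List.forall_mem_cons.2 ⟨hmono (le_max_right T T') hT',
        fun b' hb' => hmono (le_max_left T T') (hT b' hb')⟩⟩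
  obtain ⟨T, hT⟩ := hex
  exact Set.mem_iUnion.2 ⟨T + 1, Or.inl ⟨c, hc, w, hT, rfl⟩⟩

theorem exists_haltAtom_mem_iff (u : Code) (n : ℕ) :
    (∃ t, haltAtom ∈ canonicalRun (evalProgram u) n t) ↔ (u.eval n).Dom := by
  refine ⟨fun ⟨t, ht⟩ => valid_canonicalRun u n t _ ht, fun h => ?_⟩
  have hF := closedUnder_iUnion_canonicalRun u n
  have hconf := evalProgram_run_conforms u n
  have hzero : zeroAtom 0 ∈ ⋃ t, canonicalRun (evalProgram u) n t :=
    Set.mem_iUnion.2 ⟨0, mem_chainInit.2 (Or.inl rfl)⟩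
  have hinput : inputAtom n ∈ ⋃ t, canonicalRun (evalProgram u) n t :=
    Set.mem_iUnion.2 ⟨0, mem_chainInit.2 (Or.inr (Or.inl rfl))⟩
  have hdom : ∀ i, domAtom i ∈ ⋃ t, canonicalRun (evalProgram u) n t := fun i =>
    Set.mem_iUnion.2 ⟨i, domAtom_mem_canonicalRun (evalProgram_copy u) hconf i i (by omega)⟩
  have hsucc : ∀ i, succAtom i (i + 1) ∈ ⋃ t, canonicalRun (evalProgram u) n t := fun i =>
    Set.mem_iUnion.2
      ⟨i + 1, succAtom_mem_canonicalRun (evalProgram_copy u) hconf (i + 1) i (by omega)⟩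
  have hev := hF.evalAtom_mem hzero hdom hsucc u le_rfl (Part.get_mem h)
  exact Set.mem_iUnion.1 <| hF.base_mem 7 [n, (u.eval n).get h] (by simp [baseClauses])
    (by simpa only [baseClauses, List.getElem_cons_succ, List.getElem_cons_zero,
      List.forall_mem_cons] using ⟨hinput, hev, by simp⟩)

/-! ### The reduction -/

/-- The system that searches for a value of the function with code `u` at `n`. -/
def evalSystem (u : Code) (n : ℕ) : System :=
  clauseSystem (evalSchema u) (chainInit n) (evalProgram u)

theorem evalSystem_isDCDS (u : Code) (n : ℕ) : (evalSystem u n).IsDCDS :=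
  clauseSystem_isDCDS rfl rfl rfl (chainInit_conforms u n) (evalProgram_conforms u)
    (evalProgram_safe u)

theorem evalSystem_stateBounded_iff (u : Code) (n : ℕ) :
    (evalSystem u n).StateBounded ↔ (u.eval n).Dom := by
  rw [← exists_haltAtom_mem_iff]
  constructor
  · intro h
    by_contra! hT
    exact not_stateBounded_of_haltAtom_notMem (evalProgram_copy u)
      (evalProgram_run_conforms u n) hT h
  · rintro ⟨T, hT⟩
    exact stateBounded_of_haltAtom_mem (evalProgram_copy u) (evalProgram_safe u)
      (evalProgram_run_conforms u n) hT

/-! ### Computability of the reduction -/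

theorem primrec_fact {α : Type} [Primcodable α] {r : α → ℕ} {l : α → List ℕ} (hr : Primrec r)
    (hl : Primrec l) : Primrec fun a => (⟨r a, l a⟩ : Fact) :=
  (Primrec.of_equiv_symm (e := Atom.equiv ℕ)).comp (hr.pair hl)

theorem primrec_chainInit : Primrec chainInit := by
  have hsing : ∀ {α : Type} [Primcodable α] {f : α → ℕ}, Primrec f → Primrec fun a => [f a] :=
    fun hf => Primrec.list_cons.comp hf (Primrec.const [])
  refine Primrec.list_cons.comp (Primrec.const _) (Primrec.list_cons.comp
    (primrec_fact (Primrec.const 2) (hsing Primrec.id)) (Primrec.list_append.comp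
      (Primrec.list_map (Primrec.list_range.comp Primrec.succ) ?_)
      (Primrec.list_map Primrec.list_range ?_)))
  · exact primrec_fact (Primrec.const 3) (hsing Primrec.snd)
  · exact primrec_fact (Primrec.const 4)
      (Primrec.list_cons.comp Primrec.snd (hsing (Primrec.succ.comp Primrec.snd)))

theorem primrec_clauseSystem (schema : List ℕ) (P : List Clause) :
    Primrec fun n => clauseSystem schema (chainInit n) P := by
  -- Only the initial instance depends on `n`; rules and actions are fixed data and enter as opaque
  -- constants.
  generalize hR : ([⟨.neg (.atom ⟨0, []⟩), 0⟩] : List Rule) = R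
  generalize hA : [clauseAction P] = A
  have h : Primrec fun n => (schema, ([] : List EqConstraint), chainInit n, [1], A, R) :=
    (Primrec.const schema).pair <| (Primrec.const []).pair <|
      primrec_chainInit.pair <| Primrec.const ([1], A, R)
  refine ((Primrec.of_equiv_symm (e := System.equiv)).comp h).of_eq fun n => ?_
  rw [← hR, ← hA]
  rfl

theorem primrec_evalSystem (u : Code) : Primrec (evalSystem u) :=
  primrec_clauseSystem _ _

/-- A code for the partial function that runs the code with a given number on the input `0`. -/
theorem exists_universal_code :
    ∃ u : Code, ∀ c : Code, u.eval (Encodable.encode c) = c.eval 0 := by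
  have h : Partrec fun n : ℕ => (Denumerable.ofNat Code n).eval 0 :=
    Code.eval_part.comp (Computable.ofNat Code) (Computable.const 0)
  obtain ⟨u, hu⟩ := Code.exists_code.1 (Partrec.nat_iff.1 h)
  exact ⟨u, fun c => by simp [hu]⟩

end DataCentric

theorem mainTheorem10 :
    ¬ ∃ alg : DataCentric.System →. Bool, Partrec alg ∧
      ∀ S : DataCentric.System, S.IsDCDS →
        (S.StateBounded → true ∈ alg S) ∧ (¬ S.StateBounded → false ∈ alg S) := by
  rintro ⟨alg, halg, hspec⟩
  obtain ⟨u, hu⟩ := DataCentric.exists_universal_code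
  classical
  refine ComputablePred.halting_problem 0 ⟨Classical.decPred _, ?_⟩
  -- The halting problem at input `0` is decided for `c` by running the fixed universal code `u` on
  -- the number of `c`.
  have hred : Computable fun c : Nat.Partrec.Code =>
      DataCentric.evalSystem u (Encodable.encode c) :=
    (DataCentric.primrec_evalSystem u).to_comp.comp Computable.encode
  -- Although `alg` may diverge elsewhere, every system in the range of the reduction is a DCDS, so
  -- the composition is total and decides halting.
  refine (halg.comp hred).of_eq fun c => ?_
  obtain ⟨h1, h2⟩ := hspec _ (DataCentric.evalSystem_isDCDS u (Encodable.encode c))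
  rw [DataCentric.evalSystem_stateBounded_iff, hu] at h1 h2
  by_cases h : (c.eval 0).Dom
  · simpa [h] using Part.eq_some_iff.2 (h1 h)
  · simpa [h] using Part.eq_some_iff.2 (h2 h)
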